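/- **Setting.** Let $n$ robots be placed independently and uniformly at random at points $x_1,\dots,x_n$ of a boundary $[0,s]$, $s>0$, and let $d>0$. Consider the graph whose nodes are the robots and two artificial robots at $0$ and at $s$, two nodes being adjacent iff their distance is at most $d$. The configuration is connected iff this graph has a path from the node at $0$ to the node at $s$; $p_{\mathrm{con}}(s,d,n)$ denotes the probability of this event. The problem $\mathrm{PCON}(\mathrm{Uni})$ is: given rationals $s,d>0$ (as pairs of numerator and denominator) and $n\in\mathbb N=\{0,1,2,\dots\}$, write down $p_{\mathrm{con}}(s,d,n)\in\mathbb Q$ as an exact reduced fraction. Write $|q|$ for the number of symbols of a rational $q$ written as a reduced fraction in binary. Algorithms are programs for a random access machine whose cells hold exact rational numbers. An assignment with one arithmetic operation $+,-,\times,/$, or a comparison of two cells, takes one unit of time, and so does the writing of each output symbol (so writing a rational $q$ takes time $|q|$). **Theorem.** 1. For all real $s,d>0$ and all $n\ge 1$, $$p_{\mathrm{con}}(s,d,n)=1-\sum_{k=1}^{\lfloor s/d\rfloor}(-1)^{k-1}\binom{n+1}{k}\Bigl(1-\frac{kd}{s}\Bigr)^n .$$ 2. (Upper bound.) There are a single program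 and a constant $C$ such that for all rational $s,d>0$ and all $n\in\mathbb N$ the program writes $q=p_{\mathrm{con}}(s,d,n)$ as a reduced fraction and halts, in a time $t$ with $$t\le C\,(n\log n+1)+|q|\qquad\text{and}\qquad t\le C\,\bigl(n(\log n+|s|+|d|)+1\bigr)$$ (with $n\log n=0$ for $n=0$). That is, apart from the time for writing the result the program takes $O(n\log n)$ time uniformly in $s$ and $d$, and its whole running time is $O(n\log n)$ whenever $|s|$ and $|d|$ are $O(\log n)$, in particular for fixed $s$ and $d$. 3. (Lower bound.) Any program that solves the problem needs $\Omega(n)$ time: for every program, every rational $d>0$ and every $n\in\mathbb N$, if the program on the input $(\tfrac43d,d,n)$ halts after $t$ units of time with the output $p_{\mathrm{con}}(\tfrac43d,d,n)$, then $t\ge n$. 4. On these instances the output is exponentially large relative to the input: for every rational $d>0$ and every $n\in\mathbb N$, $p_{\mathrm{con}}(\tfrac43d,d,n)=1-\frac{n+1}{4^n}$ and $|p_{\mathrm{con}}(\tfrac43d,d,n)|\ge n$, whereas for every rational $d>0$ there is a constant $C$ such that the input $(\tfrac43d,d,n)$ has size at most $C\log n$ for all $n\ge 2$ (input numbers being written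 in binary, rationals as reduced fractions). -/

import Mathlib

namespace SCS

/-! ### The random geometric graph of a team of point robots on a boundary -/

/-- The positions of all nodes of the graph: the artificial robot at `0`, the `n` robots, and the
artificial robot at `s`. -/
def nodePos (s : ℝ) {n : ℕ} (x : Fin n → ℝ) : Fin (n + 2) → ℝ :=
  Fin.cons 0 (Fin.snoc x s)

/-- The communication graph: two distinct nodes are adjacent iff their distance is at most `d`. -/
def commGraph (s d : ℝ) {n : ℕ} (x : Fin n → ℝ) : SimpleGraph (Fin (n + 2)) where
  Adj i j := i ≠ j ∧ |nodePos s x i - nodePos s x j| ≤ d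
  symm := ⟨fun _ _ h => ⟨h.1.symm, by rw [abs_sub_comm]; exact h.2⟩⟩
  loopless := ⟨fun _ h => h.1 rfl⟩

/-- A configuration is connected iff the graph has a path between the two ends of the boundary. -/
def IsConnectedConfig (s d : ℝ) {n : ℕ} (x : Fin n → ℝ) : Prop :=
  (commGraph s d x).Reachable 0 (Fin.last (n + 1))

/-- The law of `n` independent positions, each uniformly distributed on `[0, s]`. -/
noncomputable def uniformPositions (s : ℝ) (n : ℕ) : MeasureTheory.Measure (Fin n → ℝ) :=
  MeasureTheory.Measure.pi fun _ =>
    ProbabilityTheory.cond MeasureTheory.volume (Set.Icc (0 : ℝ) s)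

/-- The probability of connectivity of `n` robots placed i.i.d. uniformly on `[0, s]`, with
communication range `d`. -/
noncomputable def pcon (s d : ℝ) (n : ℕ) : ℝ :=
  (uniformPositions s n).real {x | IsConnectedConfig s d x}

/-! ### Exact reduced fractions written in binary -/

/-- The symbols of the output tape. -/
inductive Sym
  | bit (b : Bool)
  | slash
  | minus

/-- A rational number written as its reduced fraction: an optional sign, the binary digits of the
numerator, a slash, the binary digits of the denominator (least significant digits first). -/
def encodeRat (q : ℚ) : List Sym :=
  (if q < 0 then [Sym.minus] else []) ++ (Nat.bits q.num.natAbs).map Sym.bit ++ [Sym.slash] ++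
    (Nat.bits q.den).map Sym.bit

/-- The number of symbols of a rational number written as a reduced fraction. -/
def ratSize (q : ℚ) : ℕ := (encodeRat q).length

/-- The size of the input `(s, d, n)`, all numbers being written in binary. -/
def inputSize (s d : ℚ) (n : ℕ) : ℕ := ratSize s + ratSize d + (Nat.bits n).length

/-! ### Random access machines with exact rational arithmetic

The cells of the memory hold exact rational numbers. An arithmetic operation, a comparison and
the writing of one symbol each take one unit of time. -/

/-- The address of a memory cell, given directly or through the content of another cell. -/
inductive Addr
  | dir (i : ℕ)
  | ind (i : ℕ)

def Addr.eval (m : ℕ → ℚ) : Addr → ℕ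
  | .dir i => i
  | .ind i => ⌊m i⌋₊

/-- An operand: a constant or the content of a memory cell. -/
inductive Operand
  | const (q : ℚ)
  | cell (a : Addr)

def Operand.eval (m : ℕ → ℚ) : Operand → ℚ
  | .const q => q
  | .cell a => m (a.eval m)

inductive ArithOp
  | add
  | sub
  | mul
  | div

/-- The value of an arithmetic operation (a division by zero returns zero). -/
def ArithOp.eval : ArithOp → ℚ → ℚ → ℚ
  | .add, x, y => x + y
  | .sub, x, y => x - y
  | .mul, x, y => x * y
  | .div, x, y => x / y

inductive Cmp
  | le
  | lt
  | eq

def Cmp.Holds : Cmp → ℚ → ℚ → Prop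
  | .le, x, y => x ≤ y
  | .lt, x, y => x < y
  | .eq, x, y => x = y

/-- Programs. `assign a o x y` stores the value of `x o y` in the cell `a`, `emit c` writes the
symbol `c`, and `print x` writes the value of `x` as a reduced fraction. -/
inductive Program
  | skip
  | assign (a : Addr) (o : ArithOp) (x y : Operand)
  | emit (c : Sym)
  | print (x : Operand)
  | seq (P Q : Program)
  | ite (c : Cmp) (x y : Operand) (P Q : Program)
  | while (c : Cmp) (x y : Operand) (P : Program)

/-- The memory of a machine and the string it has written so far. -/
structure Config where
  mem : ℕ → ℚ
  out : List Sym

/-- `Exec P σ t τ`: started in the configuration `σ`, the program `P` halts after exactly `t` units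
of time in the configuration `τ`. -/
inductive Exec : Program → Config → ℕ → Config → Prop
  | skip (σ : Config) : Exec .skip σ 1 σ
  | assign (a : Addr) (o : ArithOp) (x y : Operand) (σ : Config) :
      Exec (.assign a o x y) σ 1
        ⟨Function.update σ.mem (a.eval σ.mem) (o.eval (x.eval σ.mem) (y.eval σ.mem)), σ.out⟩
  | emit (c : Sym) (σ : Config) : Exec (.emit c) σ 1 ⟨σ.mem, σ.out ++ [c]⟩
  | print (x : Operand) (σ : Config) :
      Exec (.print x) σ (ratSize (x.eval σ.mem)) ⟨σ.mem, σ.out ++ encodeRat (x.eval σ.mem)⟩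
  | seq {P Q : Program} {σ ρ τ : Config} {t u : ℕ} :
      Exec P σ t ρ → Exec Q ρ u τ → Exec (.seq P Q) σ (t + u) τ
  | ite_true {c : Cmp} {x y : Operand} {P Q : Program} {σ τ : Config} {t : ℕ} :
      c.Holds (x.eval σ.mem) (y.eval σ.mem) → Exec P σ t τ → Exec (.ite c x y P Q) σ (t + 1) τ
  | ite_false {c : Cmp} {x y : Operand} {P Q : Program} {σ τ : Config} {t : ℕ} :
      ¬ c.Holds (x.eval σ.mem) (y.eval σ.mem) → Exec Q σ t τ → Exec (.ite c x y P Q) σ (t + 1) τ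
  | while_true {c : Cmp} {x y : Operand} {P : Program} {σ ρ τ : Config} {t u : ℕ} :
      c.Holds (x.eval σ.mem) (y.eval σ.mem) → Exec P σ t ρ → Exec (.while c x y P) ρ u τ →
        Exec (.while c x y P) σ (t + u + 1) τ
  | while_false {c : Cmp} {x y : Operand} {P : Program} {σ : Config} :
      ¬ c.Holds (x.eval σ.mem) (y.eval σ.mem) → Exec (.while c x y P) σ 1 σ

/-- The initial configuration on the input `(s, d, n)`: the rational numbers `s` and `d` are given
as pairs of a numerator and a denominator, all other cells hold zero, nothing is written. -/
def initConfig (s d : ℚ) (n : ℕ) : Config where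
  mem := fun i => match i with
    | 0 => s.num
    | 1 => s.den
    | 2 => d.num
    | 3 => d.den
    | 4 => n
    | _ => 0
  out := []

/-- On the input `(s, d, n)`, the program `P` halts after exactly `t` units of time, and then its
whole output is the reduced fraction `q`. -/
def Outputs (P : Program) (s d : ℚ) (n t : ℕ) (q : ℚ) : Prop :=
  ∃ m : ℕ → ℚ, Exec P (initConfig s d n) t ⟨m, encodeRat q⟩

/-- On the input `(s, d, n)`, the program `P` solves the problem of computing the probability of
connectivity exactly, in exactly `t` units of time. -/
def SolvesIn (P : Program) (s d : ℚ) (n t : ℕ) : Prop :=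
  ∃ q : ℚ, (q : ℝ) = pcon s d n ∧ Outputs P s d n t q

end SCS

/-! Almost surely all robots lie in the open interval, and then connectivity means that no node left
of `s` is followed by a gap longer than `d` (`isConnectedConfig_iff_noGap`). Conditioning on the
position `u` of the leftmost robot and translating by `u` leaves a connected configuration of one
robot fewer on `[0, s - u]`. Hence the volume satisfies `V (n+1) s = (n+1) * ∫ u in 0..d, V n (s -
u)` (`volume_connRegion_succ`). The inclusion-exclusion sum over the `n + 1` gaps, written with
truncated powers, satisfies the same recursion by Pascal's rule (`connVolume_succ`).

The program evaluates this sum. Its number of terms is capped at `n + 2` whatever `s / d` is, each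
signed binomial coefficient comes from the previous one in constantly many operations, and each
power costs `O(log n)` by repeated squaring (`exec_sumLoop`). The result lies in `[0, 1]` and has a
denominator dividing `(s.num * d.den) ^ n`, which bounds the cost of writing it
(`ratSize_pconRat_le`).

The lower bound is an output bound: writing a symbol takes a unit of time (`Exec.length_out_le`),
and `1 - (n+1)/4^n` has a reduced denominator of at least `2^n` (`le_ratSize_one_sub_div`). -/

open MeasureTheory Set

namespace SCS

/-! ### Connectivity through gaps -/

/-- No node other than the right end is followed by a gap longer than `d`. -/
def NoGap (s d : ℝ) {n : ℕ} (x : Fin n → ℝ) : Prop :=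
  (d < s → ∃ j, 0 < x j ∧ x j ≤ d) ∧ ∀ i, x i + d < s → ∃ j, x i < x j ∧ x j ≤ x i + d

lemma nodePos_zero (s : ℝ) {n : ℕ} (x : Fin n → ℝ) : nodePos s x 0 = 0 := rfl

lemma nodePos_last (s : ℝ) {n : ℕ} (x : Fin n → ℝ) : nodePos s x (Fin.last (n + 1)) = s := by
  rw [nodePos, ← Fin.succ_last, Fin.cons_succ, Fin.snoc_last]

lemma nodePos_robot (s : ℝ) {n : ℕ} (x : Fin n → ℝ) (i : Fin n) :
    nodePos s x i.castSucc.succ = x i := by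
  rw [nodePos, Fin.cons_succ, Fin.snoc_castSucc]

lemma node_cases {n : ℕ} (a : Fin (n + 2)) :
    a = 0 ∨ (∃ i : Fin n, a = i.castSucc.succ) ∨ a = Fin.last (n + 1) := by
  induction a using Fin.cases with
  | zero => exact Or.inl rfl
  | succ a =>
    induction a using Fin.lastCases with
    | last => exact Or.inr (Or.inr rfl)
    | cast i => exact Or.inr (Or.inl ⟨i, rfl⟩)

/-- If `p` is followed by a gap longer than `d`, then a path from `0` does not get beyond `p`. -/
lemma not_isConnectedConfig_of_gap {s d p : ℝ} {n : ℕ} {x : Fin n → ℝ} (hd : 0 < d) (hp : 0 ≤ p)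
    (hps : p + d < s) (h : ∀ j, ¬ (p < x j ∧ x j ≤ p + d)) : ¬ IsConnectedConfig s d x := by
  rintro ⟨w⟩
  have key : ∀ {a b : Fin (n + 2)}, (commGraph s d x).Walk a b → nodePos s x a ≤ p →
      nodePos s x b ≤ p := by
    intro a b w
    induction w with
    | nil => exact id
    | @cons a c b hadj w ih =>
      intro ha
      refine ih ?_
      have hc : nodePos s x c ≤ p + d := by
        have := (abs_le.1 hadj.2).1
        linarith
      rcases node_cases c with rfl | ⟨i, rfl⟩ | rfl
      · exact hp
      · rw [nodePos_robot] at hc ⊢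
        by_contra hlt
        exact h i ⟨not_le.1 hlt, hc⟩
      · rw [nodePos_last] at hc
        linarith
  have := key w hp
  rw [nodePos_last] at this
  linarith

/-- For the converse, consider the rightmost node reachable from `0`. Were it more than `d` away
from `s`, `NoGap` would supply a reachable robot further to the right. -/
lemma isConnectedConfig_iff_noGap {s d : ℝ} {n : ℕ} {x : Fin n → ℝ} (hs : 0 < s) (hd : 0 < d)
    (hx : ∀ i, 0 < x i ∧ x i < s) : IsConnectedConfig s d x ↔ NoGap s d x := by
  constructor
  · intro h
    constructor
    · intro hds
      by_contra hne
      push Not at hne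
      exact not_isConnectedConfig_of_gap hd le_rfl (by linarith)
        (fun j hj => absurd hj.2 (not_le.2 (by simpa using hne j hj.1))) h
    · intro i hi
      by_contra hne
      push Not at hne
      exact not_isConnectedConfig_of_gap hd (hx i).1.le hi
        (fun j hj => absurd hj.2 (not_le.2 (hne j hj.1))) h
  · intro h
    obtain ⟨a, ha, hmax⟩ := Set.exists_max_image {a | (commGraph s d x).Reachable 0 a}
      (nodePos s x) (Set.toFinite _) ⟨0, SimpleGraph.Reachable.refl _⟩
    by_cases hal : a = Fin.last (n + 1)
    · rw [hal] at ha
      exact ha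
    have hge : s ≤ nodePos s x a + d := by
      by_contra hlt
      rw [not_le] at hlt
      obtain ⟨j, hj1, hj2⟩ : ∃ j, nodePos s x a < x j ∧ x j ≤ nodePos s x a + d := by
        rcases node_cases a with rfl | ⟨i, rfl⟩ | rfl
        · obtain ⟨j, hj⟩ := h.1 (by simpa [nodePos_zero] using hlt)
          exact ⟨j, by simpa [nodePos_zero] using hj⟩
        · rw [nodePos_robot] at hlt ⊢
          exact h.2 i hlt
        · exact absurd rfl hal
      have hadj : (commGraph s d x).Adj a j.castSucc.succ := by
        refine ⟨?_, ?_⟩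
        · rintro rfl
          rw [nodePos_robot] at hj1
          exact lt_irrefl _ hj1
        · rw [nodePos_robot, abs_le]
          constructor <;> linarith
      have := hmax _ (SimpleGraph.Reachable.trans ha hadj.reachable)
      rw [nodePos_robot] at this
      linarith
    have hle : nodePos s x a ≤ s := by
      rcases node_cases a with rfl | ⟨i, rfl⟩ | rfl
      · exact hs.le
      · rw [nodePos_robot]; exact (hx i).2.le
      · rw [nodePos_last]
    have hadj : (commGraph s d x).Adj a (Fin.last (n + 1)) := by
      refine ⟨hal, ?_⟩
      rw [nodePos_last, abs_le]
      constructor <;> linarith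
    exact SimpleGraph.Reachable.trans ha hadj.reachable

/-! ### The region of the connected configurations -/

/-- The connected configurations of `n` robots inside `(0, s)`. -/
def connRegion (n : ℕ) (d s : ℝ) : Set (Fin n → ℝ) :=
  {x | 0 < s ∧ (∀ i, 0 < x i ∧ x i < s) ∧ NoGap s d x}

/-- The connected configurations in which the robot `i` is the leftmost one. -/
def leftmostRegion (n : ℕ) (d s : ℝ) (i : Fin (n + 1)) : Set (Fin (n + 1) → ℝ) :=
  {x | x ∈ connRegion (n + 1) d s ∧ ∀ j, x i < x (i.succAbove j)}

lemma measurableSet_connRegion (n : ℕ) (d s : ℝ) : MeasurableSet (connRegion n d s) := by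
  unfold connRegion NoGap
  measurability

lemma measurableSet_leftmostRegion (n : ℕ) (d s : ℝ) (i : Fin (n + 1)) :
    MeasurableSet (leftmostRegion n d s i) := by
  have : MeasurableSet (⋂ j, {x : Fin (n + 1) → ℝ | x i < x (i.succAbove j)}) :=
    MeasurableSet.iInter fun j => measurableSet_lt (measurable_pi_apply _) (measurable_pi_apply _)
  convert (measurableSet_connRegion (n + 1) d s).inter this using 1
  ext x
  simp [leftmostRegion]

/-- After translation by `-u` the leftmost robot plays the part of the artificial robot at `0`: its
own gap condition becomes that of the left end, and being leftmost becomes positivity of the others.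
-/
lemma insertNth_mem_leftmostRegion {n : ℕ} {d s : ℝ} (i : Fin (n + 1)) (u : ℝ)
    (y : Fin n → ℝ) :
    i.insertNth (α := fun _ => ℝ) u y ∈ leftmostRegion n d s i ↔
      u ∈ Ioc 0 d ∧ y - Function.const _ u ∈ connRegion n d (s - u) := by
  simp only [leftmostRegion, connRegion, NoGap, mem_ofPred_eq, i.forall_iff_succAbove,
    i.exists_iff_succAbove, Fin.insertNth_apply_same, Fin.insertNth_apply_succAbove, mem_Ioc,
    Pi.sub_apply, Function.const_apply]
  constructor
  · rintro ⟨⟨hs, ⟨⟨hu0, hus⟩, hy⟩, h0, hu, hyg⟩, hlt⟩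
    refine ⟨⟨hu0, ?_⟩, by linarith, fun j => ⟨by linarith [hlt j], by linarith [(hy j).2]⟩, ?_, ?_⟩
    -- If `s ≤ d`, the left end imposes no gap condition, but `u < s ≤ d` holds anyway.
    · by_cases hds : d < s
      · rcases h0 hds with h | ⟨j, hj⟩
        · exact h.2
        · linarith [hlt j]
      · linarith
    · intro h
      rcases hu (by linarith) with h | ⟨j, hj⟩
      · exact absurd h.1 (lt_irrefl _)
      · exact ⟨j, by linarith, by linarith⟩
    · intro j h
      rcases hyg j (by linarith) with h | ⟨k, hk⟩
      · linarith [hlt j]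
      · exact ⟨k, by linarith, by linarith⟩
  · rintro ⟨⟨hu0, hud⟩, hs, hy, h0, hyg⟩
    refine ⟨⟨by linarith, ⟨⟨hu0, by linarith⟩, fun j => ⟨by linarith [(hy j).1],
      by linarith [(hy j).2]⟩⟩, fun _ => Or.inl ⟨hu0, hud⟩, ?_, ?_⟩, fun j => by linarith [(hy j).1]⟩
    · intro h
      obtain ⟨j, hj⟩ := h0 (by linarith)
      exact Or.inr ⟨j, by linarith, by linarith⟩
    · intro j h
      obtain ⟨k, hk⟩ := hyg j (by linarith)
      exact Or.inr ⟨k, by linarith, by linarith⟩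

/-- Fubini in the coordinate `i`, then translation invariance of Lebesgue measure on each slice. -/
lemma volume_leftmostRegion {n : ℕ} {d s : ℝ} (i : Fin (n + 1)) :
    volume (leftmostRegion n d s i) = ∫⁻ u in Ioc 0 d, volume (connRegion n d (s - u)) := by
  have hmp := (volume_preserving_piFinSuccAbove (fun _ : Fin (n + 1) => ℝ) i).symm
  rw [← hmp.measure_preimage_equiv, Measure.volume_eq_prod,
    Measure.prod_apply ((MeasurableEquiv.measurable _) (measurableSet_leftmostRegion n d s i)),
    ← lintegral_indicator measurableSet_Ioc]
  refine lintegral_congr fun u => ?_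
  have hset : Prod.mk u ⁻¹' ((MeasurableEquiv.piFinSuccAbove (fun _ : Fin (n + 1) => ℝ) i).symm ⁻¹'
      leftmostRegion n d s i) =
      {y | u ∈ Ioc 0 d ∧ y - Function.const _ u ∈ connRegion n d (s - u)} := by
    ext y
    exact insertNth_mem_leftmostRegion i u y
  rw [hset]
  by_cases hu : u ∈ Ioc 0 d
  · rw [indicator_of_mem hu]
    simp only [hu, true_and]
    simp_rw [sub_eq_add_neg]
    exact measure_preimage_add_right volume _ _
  · rw [indicator_of_notMem hu]
    simp [hu]

/-- The set is the kernel of a nonzero linear form, hence a proper subspace. -/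
lemma volume_eq_coord_eq_zero {n : ℕ} {i j : Fin n} (hij : i ≠ j) :
    volume {x : Fin n → ℝ | x i = x j} = 0 := by
  let f : (Fin n → ℝ) →ₗ[ℝ] ℝ := LinearMap.proj (R := ℝ) (φ := fun _ => ℝ) i - LinearMap.proj j
  have hf : LinearMap.ker f ≠ ⊤ := by
    intro h
    have : f (Pi.single i 1) = 0 := by
      rw [← LinearMap.mem_ker, h]; trivial
    simp [f, hij.symm] at this
  have := Measure.addHaar_submodule (volume : Measure (Fin n → ℝ)) _ hf
  convert this using 2
  ext x
  simp [f, sub_eq_zero]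

/-- Ties are negligible, so almost every configuration has a strictly leftmost robot. -/
lemma iUnion_leftmostRegion_ae_eq (n : ℕ) (d s : ℝ) :
    (⋃ i, leftmostRegion n d s i) =ᵐ[volume] connRegion (n + 1) d s := by
  have hne : ∀ᵐ x : Fin (n + 1) → ℝ, ∀ i j, i ≠ j → x i ≠ x j := by
    simp only [ae_all_iff]
    intro i j hij
    rw [ae_iff]
    simpa using volume_eq_coord_eq_zero hij
  filter_upwards [hne] with x hx
  refine propext ⟨fun h => ?_, fun h => ?_⟩
  · obtain ⟨i, hi⟩ := mem_iUnion.1 h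
    exact hi.1
  · obtain ⟨i, hi⟩ := Finite.exists_min x
    exact mem_iUnion.2 ⟨i, h, fun j => lt_of_le_of_ne (hi _) (hx _ _ (Fin.succAbove_ne i j).symm)⟩

lemma pairwise_disjoint_leftmostRegion (n : ℕ) (d s : ℝ) :
    Pairwise (Function.onFun Disjoint (leftmostRegion n d s)) := by
  intro i j hij
  refine Set.disjoint_left.2 fun x hi hj => ?_
  obtain ⟨k, rfl⟩ := Fin.exists_succAbove_eq hij.symm
  obtain ⟨l, hl⟩ := Fin.exists_succAbove_eq hij
  have h1 := hi.2 k
  have h2 := hj.2 l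
  rw [hl] at h2
  exact lt_asymm h1 h2

/-- Recursion for the volume, by the position of the leftmost robot. -/
lemma volume_connRegion_succ (n : ℕ) (d s : ℝ) :
    volume (connRegion (n + 1) d s) =
      (n + 1) * ∫⁻ u in Ioc 0 d, volume (connRegion n d (s - u)) := by
  rw [← measure_congr (iUnion_leftmostRegion_ae_eq n d s),
    measure_iUnion (pairwise_disjoint_leftmostRegion n d s) (measurableSet_leftmostRegion n d s),
    tsum_fintype]
  simp [volume_leftmostRegion]

/-! ### Truncated powers -/

/-- The power `t ^ n` for `t > 0`, and zero for `t ≤ 0`. -/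
noncomputable def posPow (n : ℕ) (t : ℝ) : ℝ := if 0 < t then t ^ n else 0

lemma posPow_of_pos (n : ℕ) {t : ℝ} (ht : 0 < t) : posPow n t = t ^ n := if_pos ht

lemma posPow_of_nonpos (n : ℕ) {t : ℝ} (ht : t ≤ 0) : posPow n t = 0 := if_neg (not_lt.2 ht)

lemma monotone_posPow (n : ℕ) : Monotone (posPow n) := by
  intro a b hab
  rcases le_or_gt a 0 with ha | ha
  · rw [posPow_of_nonpos n ha]
    unfold posPow
    split_ifs with hb
    · positivity
    · exact le_rfl
  · rw [posPow_of_pos n ha, posPow_of_pos n (ha.trans_le hab)]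
    gcongr

/-- The exponent `0` is excluded: `max t 0 ^ 0` is `1` for all `t`, whereas `posPow 0` vanishes on
`t ≤ 0`. -/
lemma posPow_succ_eq_max (n : ℕ) (t : ℝ) : posPow (n + 1) t = max t 0 ^ (n + 1) := by
  rcases le_or_gt t 0 with ht | ht
  · rw [posPow_of_nonpos _ ht, max_eq_right ht, zero_pow (Nat.succ_ne_zero n)]
  · rw [posPow_of_pos _ ht, max_eq_left ht.le]

lemma continuous_posPow_succ (n : ℕ) : Continuous (posPow (n + 1)) := by
  have : posPow (n + 1) = fun t => max t 0 ^ (n + 1) := funext (posPow_succ_eq_max n)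
  rw [this]
  fun_prop

lemma hasDerivAt_posPow_succ (n : ℕ) {t : ℝ} (ht : t ≠ 0) :
    HasDerivAt (posPow (n + 1)) ((n + 1) * posPow n t) t := by
  rcases lt_or_gt_of_ne ht with h | h
  · rw [posPow_of_nonpos n h.le, mul_zero]
    refine (hasDerivAt_const t (0 : ℝ)).congr_of_eventuallyEq ?_
    filter_upwards [Iio_mem_nhds h] with x hx
    exact posPow_of_nonpos _ (le_of_lt hx)
  · rw [posPow_of_pos n h]
    have := hasDerivAt_pow (n + 1) t
    push_cast at this
    refine this.congr_of_eventuallyEq ?_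
    filter_upwards [Ioi_mem_nhds h] with x hx
    exact posPow_of_pos _ hx

/-- The derivative may fail to exist at the kink `t = 0` (it does for `n = 0`), so the fundamental
theorem is used with a countable exceptional set; monotonicity gives integrability. -/
lemma integral_posPow (n : ℕ) (a b : ℝ) :
    ∫ t in a..b, (n + 1) * posPow n t = posPow (n + 1) b - posPow (n + 1) a :=
  integral_eq_of_hasDerivAt_off_countable _ _ (countable_singleton 0)
    (continuous_posPow_succ n).continuousOn (fun _ hx => hasDerivAt_posPow_succ n hx.2)
    ((monotone_posPow n).intervalIntegrable.const_mul _)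

lemma integral_posPow_sub (n : ℕ) (a d : ℝ) :
    ∫ u in (0 : ℝ)..d, (n + 1) * posPow n (a - u) = posPow (n + 1) a - posPow (n + 1) (a - d) := by
  rw [intervalIntegral.integral_comp_sub_left (fun t => ((n : ℝ) + 1) * posPow n t) a,
    integral_posPow, sub_zero]

/-- The volume of the connected configurations. -/
noncomputable def connVolume (n : ℕ) (d s : ℝ) : ℝ :=
  ∑ k ∈ Finset.range (n + 2), (-1 : ℝ) ^ k * ((n + 1).choose k : ℝ) * posPow n (s - k * d)

lemma intervalIntegrable_posPow_sub (n : ℕ) (a b c : ℝ) :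
    IntervalIntegrable (fun u => posPow n (a - u)) volume b c := by
  have : Antitone fun u => posPow n (a - u) := fun u v h => monotone_posPow n (by linarith)
  exact this.intervalIntegrable

lemma intervalIntegrable_connVolume_sub (n : ℕ) (d s b c : ℝ) :
    IntervalIntegrable (fun u => connVolume n d (s - u)) volume b c := by
  have hsum : (fun u => connVolume n d (s - u)) = ∑ k ∈ Finset.range (n + 2), fun u =>
      (-1 : ℝ) ^ k * ((n + 1).choose k : ℝ) * posPow n (s - u - k * d) := by
    ext u
    simp [connVolume]
  rw [hsum]
  refine IntervalIntegrable.sum _ fun k _ => ?_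
  refine IntervalIntegrable.const_mul ?_ _
  simp_rw [sub_right_comm s _ (_ * d)]
  exact intervalIntegrable_posPow_sub n _ b c

/-- Each summand integrates to a difference of truncated powers at `s - k * d` and `s - (k + 1) *
d`; collecting equal arguments adds neighbouring binomial coefficients. -/
lemma connVolume_succ (n : ℕ) (d s : ℝ) :
    connVolume (n + 1) d s = (n + 1) * ∫ u in (0 : ℝ)..d, connVolume n d (s - u) := by
  have hint : (n + 1) * ∫ u in (0 : ℝ)..d, connVolume n d (s - u) =
      ∑ k ∈ Finset.range (n + 2), (-1 : ℝ) ^ k * ((n + 1).choose k : ℝ) *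
        (posPow (n + 1) (s - k * d) - posPow (n + 1) (s - (k + 1 : ℕ) * d)) := by
    unfold connVolume
    rw [intervalIntegral.integral_finsetSum, Finset.mul_sum]
    · refine Finset.sum_congr rfl fun k _ => ?_
      rw [intervalIntegral.integral_const_mul, mul_left_comm, ← intervalIntegral.integral_const_mul]
      simp_rw [sub_right_comm s _ (_ * d)]
      rw [integral_posPow_sub]
      congr 3
      push_cast
      ring
    · intro k _
      refine IntervalIntegrable.const_mul ?_ _
      simp_rw [sub_right_comm s _ (_ * d)]
      exact intervalIntegrable_posPow_sub n _ 0 d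
  rw [hint]
  simp_rw [mul_sub]
  rw [Finset.sum_sub_distrib, connVolume, Finset.sum_range_succ',
    Finset.sum_range_succ' (fun k => (-1 : ℝ) ^ k * ((n + 1).choose k : ℝ) *
      posPow (n + 1) (s - k * d))]
  have h : ∀ k : ℕ, (-1 : ℝ) ^ (k + 1) * ((n + 1 + 1).choose (k + 1) : ℝ) *
      posPow (n + 1) (s - (k + 1 : ℕ) * d) =
      (-1 : ℝ) ^ (k + 1) * ((n + 1).choose (k + 1) : ℝ) * posPow (n + 1) (s - (k + 1 : ℕ) * d) -
      (-1 : ℝ) ^ k * ((n + 1).choose k : ℝ) * posPow (n + 1) (s - (k + 1 : ℕ) * d) := by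
    intro k
    rw [Nat.choose_succ_succ]
    push_cast
    ring
  -- The top term split off here carries `(n + 1).choose (n + 2) = 0`.
  rw [Finset.sum_congr rfl fun k _ => h k, Finset.sum_sub_distrib, Finset.sum_range_succ _ (n + 1)]
  simp
  ring

/-- Both sides obey the same recursion. Nonnegativity is carried through the induction because it is
needed to turn the Lebesgue integral of `ENNReal.ofReal` into a real integral. -/
lemma volume_connRegion {d : ℝ} (hd : 0 < d) (n : ℕ) (s : ℝ) :
    0 ≤ connVolume n d s ∧ volume (connRegion n d s) = ENNReal.ofReal (connVolume n d s) := by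
  induction n generalizing s with
  | zero =>
    -- Without robots, connectivity says that the two ends are adjacent. The conjunct `0 < s` in
    -- `connRegion` matters here, since the recursion also reaches lengths `s - u ≤ 0`.
    have hW : connVolume 0 d s = if 0 < s ∧ s ≤ d then 1 else 0 := by
      simp only [connVolume, Finset.sum_range_succ, posPow]
      by_cases h1 : 0 < s <;> by_cases h2 : s ≤ d
      · simp [h1, h2]
      · simp [h1, h2, not_le.1 h2]
      · simp [h1, h2]
      · linarith
    have hE : connRegion 0 d s = if 0 < s ∧ s ≤ d then univ else ∅ := by
      ext x
      split_ifs with h <;> simpa [connRegion, NoGap] using h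
    rw [hW, hE]
    split_ifs
    · simp [volume_pi]
    · simp
  | succ n ih =>
    have hnn : 0 ≤ ∫ u in (0 : ℝ)..d, connVolume n d (s - u) :=
      intervalIntegral.integral_nonneg hd.le fun u _ => (ih (s - u)).1
    rw [connVolume_succ]
    refine ⟨by positivity, ?_⟩
    rw [volume_connRegion_succ, ENNReal.ofReal_mul (by positivity),
      intervalIntegral.integral_of_le hd.le, ofReal_integral_eq_lintegral_ofReal]
    · simp_rw [(ih _).2]
      congr 1
      rw [← Nat.cast_succ, ← Nat.cast_succ, ENNReal.ofReal_natCast]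
    · exact (intervalIntegrable_iff_integrableOn_Ioc_of_le hd.le).1
        (intervalIntegrable_connVolume_sub n d s 0 d)
    · exact Filter.Eventually.of_forall fun u => (ih (s - u)).1

/-! ### The probability of connectivity -/

/-- Closed and open intervals differ by a null set; the open box puts every robot strictly between
the ends. -/
lemma uniformPositions_eq (s : ℝ) (n : ℕ) :
    uniformPositions s n =
      (ENNReal.ofReal s)⁻¹ ^ n • (volume : Measure (Fin n → ℝ)).restrict
        (univ.pi fun _ => Ioo 0 s) := by
  have hc : ProbabilityTheory.cond volume (Icc (0 : ℝ) s) =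
      (ENNReal.ofReal s)⁻¹ • volume.restrict (Ioo 0 s) := by
    rw [ProbabilityTheory.cond, Real.volume_Icc, sub_zero, Measure.restrict_congr_set Ioo_ae_eq_Icc]
  rw [uniformPositions, hc]
  have : IsFiniteMeasure ((ENNReal.ofReal s)⁻¹ • volume.restrict (Ioo 0 s)) := by
    rw [← hc]; infer_instance
  refine Measure.pi_eq fun t ht => ?_
  rw [Measure.smul_apply, volume_pi, Measure.restrict_pi_pi, Measure.pi_pi]
  simp [Finset.prod_mul_distrib]

/-- The probability of connectivity, for all numbers of robots. -/
theorem pcon_eq_connVolume_div {s d : ℝ} (hs : 0 < s) (hd : 0 < d) (n : ℕ) :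
    pcon s d n = connVolume n d s / s ^ n := by
  have hset : {x : Fin n → ℝ | IsConnectedConfig s d x} ∩ univ.pi (fun _ => Ioo 0 s) =
      connRegion n d s := by
    ext x
    simp only [mem_inter_iff, mem_ofPred_eq, mem_univ_pi, mem_Ioo, connRegion]
    constructor
    · rintro ⟨h, hx⟩
      exact ⟨hs, hx, (isConnectedConfig_iff_noGap hs hd hx).1 h⟩
    · rintro ⟨-, hx, h⟩
      exact ⟨(isConnectedConfig_iff_noGap hs hd hx).2 h, hx⟩
  rw [pcon, Measure.real, uniformPositions_eq s, Measure.smul_apply, Measure.restrict_apply',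
    hset, (volume_connRegion hd n s).2]
  · rw [smul_eq_mul, ENNReal.toReal_mul, ENNReal.toReal_ofReal (volume_connRegion hd n s).1,
      ENNReal.toReal_pow, ENNReal.toReal_inv, ENNReal.toReal_ofReal hs.le, inv_pow, mul_comm,
      div_eq_mul_inv]
  · exact MeasurableSet.univ_pi fun _ => measurableSet_Ioo

lemma posPow_div (n : ℕ) {s : ℝ} (hs : 0 < s) (t : ℝ) : posPow n t / s ^ n = posPow n (t / s) := by
  rcases le_or_gt t 0 with ht | ht
  · rw [posPow_of_nonpos n ht, posPow_of_nonpos n (div_nonpos_of_nonpos_of_nonneg ht hs.le),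
      zero_div]
  · rw [posPow_of_pos n ht, posPow_of_pos n (by positivity), div_pow]

theorem pcon_eq_sum {s d : ℝ} (hs : 0 < s) (hd : 0 < d) (n : ℕ) :
    pcon s d n = ∑ k ∈ Finset.range (n + 2),
      (-1 : ℝ) ^ k * ((n + 1).choose k : ℝ) * posPow n (1 - k * d / s) := by
  rw [pcon_eq_connVolume_div hs hd, connVolume, Finset.sum_div]
  refine Finset.sum_congr rfl fun k _ => ?_
  rw [mul_div_assoc, posPow_div n hs, sub_div, div_self hs.ne']

/-- The probability of connectivity of at least one robot. -/
theorem pcon_eq_one_sub_sum {s d : ℝ} (hs : 0 < s) (hd : 0 < d) {n : ℕ} (hn : 1 ≤ n) :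
    pcon s d n = 1 - ∑ k ∈ Finset.Icc 1 ⌊s / d⌋₊,
      (-1 : ℝ) ^ (k - 1) * ((n + 1).choose k : ℝ) * (1 - (k : ℝ) * d / s) ^ n := by
  have hterm : ∀ k : ℕ, 1 ≤ k → (-1 : ℝ) ^ k * ((n + 1).choose k : ℝ) * posPow n (1 - k * d / s) =
      if k ≤ ⌊s / d⌋₊ then
        -((-1 : ℝ) ^ (k - 1) * ((n + 1).choose k : ℝ) * (1 - (k : ℝ) * d / s) ^ n) else 0 := by
    intro k hk
    have hle : k ≤ ⌊s / d⌋₊ ↔ 0 ≤ 1 - k * d / s := by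
      rw [Nat.le_floor_iff (by positivity), le_div_iff₀ hd, sub_nonneg, div_le_one hs]
    obtain ⟨m, rfl⟩ := Nat.exists_eq_add_of_le' hk
    split_ifs with h
    · rw [hle] at h
      have : posPow n (1 - ((m + 1 : ℕ) : ℝ) * d / s) = (1 - ((m + 1 : ℕ) : ℝ) * d / s) ^ n := by
        rcases h.eq_or_lt with h | h
        -- This is the case `k * d = s`, and the only place where `1 ≤ n` matters: for `n = 0` the
        -- stated sum would count `0 ^ 0 = 1`.
        · rw [← h, posPow_of_nonpos n le_rfl, zero_pow (by lia)]
        · exact posPow_of_pos n h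
      rw [this, Nat.add_sub_cancel, pow_succ]
      ring
    · rw [hle, not_le] at h
      rw [posPow_of_nonpos n h.le, mul_zero]
  have hzero : ∀ k, n + 2 ≤ k → (n + 1).choose k = 0 := fun k hk => Nat.choose_eq_zero_of_lt hk
  rw [pcon_eq_sum hs hd, sub_eq_add_neg, ← Finset.sum_neg_distrib, Finset.range_eq_Ico,
    Finset.sum_eq_sum_Ico_succ_bot (by lia)]
  congr 1
  · simp [posPow]
  · rw [zero_add, Finset.sum_congr rfl fun k hk => hterm k (Finset.mem_Ico.1 hk).1,
      ← Finset.sum_filter]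
    -- The floor may exceed `n + 1`; the additional terms have vanishing binomial coefficients.
    refine Finset.sum_subset (fun k hk => ?_) fun k hk hk' => ?_
    · simp only [Finset.mem_filter, Finset.mem_Ico] at hk
      exact Finset.mem_Icc.2 ⟨hk.1.1, hk.2⟩
    · simp only [Finset.mem_filter, Finset.mem_Ico, Finset.mem_Icc] at hk hk'
      rw [hzero k (by lia)]
      simp

end SCS

namespace SCS

/-! ### Straight-line programs -/

/-- The operand that reads the cell `i`. -/
abbrev Operand.reg (i : ℕ) : Operand := .cell (.dir i)

/-- The program that carries out a list of assignments to directly addressed cells. -/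
def block : List (ℕ × ArithOp × Operand × Operand) → Program
  | [] => .skip
  | (a, o, x, y) :: l => .seq (.assign (.dir a) o x y) (block l)

/-- The effect of a list of assignments on the memory. -/
def runBlock : List (ℕ × ArithOp × Operand × Operand) → (ℕ → ℚ) → ℕ → ℚ
  | [], m => m
  | (a, o, x, y) :: l, m => runBlock l (Function.update m a (o.eval (x.eval m) (y.eval m)))

lemma exec_block (l : List (ℕ × ArithOp × Operand × Operand)) (m : ℕ → ℚ) (out : List Sym) :
    Exec (block l) ⟨m, out⟩ (l.length + 1) ⟨runBlock l m, out⟩ := by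
  induction l generalizing m with
  | nil => exact Exec.skip _
  | cons i l ih =>
    obtain ⟨a, o, x, y⟩ := i
    have := Exec.seq (Exec.assign (.dir a) o x y ⟨m, out⟩) (ih _)
    rwa [add_comm] at this

/-! ### The program -/

/-- Doubles the cell `9` until it exceeds the cell `4`. -/
def doublingLoop : Program :=
  .while .le (.reg 9) (.reg 4) (block [(9, .mul, .reg 9, .const 2)])

/-- Multiplies a power of the cell `14` by the power of the cell `13` whose exponent is given in the
cell `15`, by repeated squaring; the cell `16` runs through descending powers of two. -/
def powerLoop : Program :=
  .while .le (.const 1) (.reg 16)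
    (.seq (block [(14, .mul, .reg 14, .reg 14)])
      (.seq (.ite .le (.reg 16) (.reg 15)
          (block [(14, .mul, .reg 14, .reg 13), (15, .sub, .reg 15, .reg 16)]) .skip)
        (block [(16, .div, .reg 16, .const 2)])))

/-- Adds one term of the sum after the other to the cell `12`. -/
def sumLoop : Program :=
  .while .lt (.reg 10) (.reg 7)
    (.seq (block [(13, .mul, .reg 10, .reg 6), (13, .div, .reg 13, .reg 5),
        (13, .sub, .const 1, .reg 13), (14, .add, .const 1, .const 0),
        (15, .add, .reg 4, .const 0), (16, .add, .reg 9, .const 0)])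
      (.seq powerLoop
        (block [(14, .mul, .reg 14, .reg 11), (12, .add, .reg 12, .reg 14),
          (17, .add, .reg 4, .const 1), (17, .sub, .reg 17, .reg 10),
          (11, .mul, .reg 11, .reg 17), (10, .add, .reg 10, .const 1),
          (11, .div, .reg 11, .reg 10), (11, .sub, .const 0, .reg 11)])))

/-- The program that writes the probability of connectivity. -/
def pconProgram : Program :=
  .seq (block [(5, .div, .reg 0, .reg 1), (6, .div, .reg 2, .reg 3), (7, .div, .reg 5, .reg 6),
      (8, .add, .reg 4, .const 2), (9, .add, .const 1, .const 0), (11, .add, .const 1, .const 0)])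
    (.seq (.ite .lt (.reg 8) (.reg 7) (block [(7, .add, .reg 8, .const 0)]) .skip)
      (.seq doublingLoop (.seq sumLoop (.print (.reg 12)))))

/-! ### Correctness and running time -/

/-- Here `r` counts the doublings still to come. One round costs `3`: two for the block and one for
the test. -/
lemma exec_doublingLoop (n r i : ℕ) (hi : i + r = n.size) (m : ℕ → ℚ) (out : List Sym)
    (h4 : m 4 = n) (h9 : m 9 = 2 ^ i) :
    ∃ t m', Exec doublingLoop ⟨m, out⟩ t ⟨m', out⟩ ∧ t ≤ 3 * r + 1 ∧ m' 9 = 2 ^ n.size ∧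
      ∀ j, j ≠ 9 → m' j = m j := by
  induction r generalizing i m with
  | zero =>
    refine ⟨1, m, Exec.while_false ?_, le_rfl, by rw [h9, ← hi, add_zero], fun _ _ => rfl⟩
    have : n < 2 ^ i := Nat.size_le.1 (by lia)
    simp only [Cmp.Holds, Operand.eval, Addr.eval, h4, h9, not_le]
    exact_mod_cast this
  | succ r ih =>
    have hle : 2 ^ i ≤ n := Nat.lt_size.1 (by lia)
    obtain ⟨t, m', he, ht, h9', hm'⟩ := ih (i + 1) (by lia)
      (runBlock [(9, .mul, .reg 9, .const 2)] m)
      (by simp [runBlock, h4]) (by simp [runBlock, Operand.eval, ArithOp.eval, Addr.eval, h9, pow_succ])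
    refine ⟨_, m', Exec.while_true ?_ (exec_block _ _ _) he, ?_, h9', fun j hj => ?_⟩
    · simp only [Cmp.Holds, Operand.eval, Addr.eval, h4, h9]
      exact_mod_cast hle
    · simp only [List.length_cons, List.length_nil]
      lia
    · rw [hm' j hj]
      simp [runBlock, hj]

/-- Invariant: `j` binary digits of the exponent are left, with value `e`. The form `2 ^ j / 2`
covers the final value `1 / 2`, at which the test `1 ≤ ·` fails. One round costs at most `2 + 4 + 2
+ 1 = 9`. -/
lemma exec_powerLoop (j e : ℕ) (he : e < 2 ^ j) (m : ℕ → ℚ) (out : List Sym) (h15 : m 15 = e)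
    (h16 : m 16 = 2 ^ j / 2) :
    ∃ t m', Exec powerLoop ⟨m, out⟩ t ⟨m', out⟩ ∧ t ≤ 9 * j + 1 ∧
      m' 14 = m 14 ^ 2 ^ j * m 13 ^ e ∧ ∀ i < 14, m' i = m i := by
  induction j generalizing e m with
  | zero =>
    refine ⟨1, m, Exec.while_false ?_, le_rfl, ?_, fun _ _ => rfl⟩
    · simp only [Cmp.Holds, Operand.eval, Addr.eval, h16]
      norm_num
    · have : e = 0 := by lia
      simp [this]
  | succ j ih =>
    have h16' : m 16 = 2 ^ j := by rw [h16, pow_succ]; ring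
    have hcond : Cmp.le.Holds ((Operand.const 1).eval m) ((Operand.reg 16).eval m) := by
      simp only [Cmp.Holds, Operand.eval, Addr.eval, h16']
      exact one_le_pow₀ (by norm_num)
    by_cases hje : 2 ^ j ≤ e
    · obtain ⟨t, m', hex, ht, h14, hm'⟩ := ih (e - 2 ^ j) (by rw [pow_succ] at he; lia)
        (runBlock [(16, .div, .reg 16, .const 2)]
          (runBlock [(14, .mul, .reg 14, .reg 13), (15, .sub, .reg 15, .reg 16)]
            (runBlock [(14, .mul, .reg 14, .reg 14)] m)))
        (by simp [runBlock, Operand.eval, ArithOp.eval, Addr.eval, h15, h16', hje])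
        (by simp [runBlock, Operand.eval, ArithOp.eval, Addr.eval, h16'])
      refine ⟨_, m', Exec.while_true hcond (Exec.seq (exec_block _ _ _)
        (Exec.seq (Exec.ite_true ?_ (exec_block _ _ _)) (exec_block _ _ _))) hex, ?_, ?_, ?_⟩
      · simp only [Cmp.Holds, Operand.eval, Addr.eval, runBlock]
        simp [h15, h16']
        exact_mod_cast hje
      · simp only [List.length_cons, List.length_nil]
        lia
      · obtain ⟨c, rfl⟩ := Nat.exists_eq_add_of_le hje
        rw [h14]
        simp [runBlock, Operand.eval, ArithOp.eval, Addr.eval]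
        ring
      · intro i hi
        rw [hm' i hi]
        have h1 : i ≠ 14 := by lia
        have h2 : i ≠ 15 := by lia
        have h3 : i ≠ 16 := by lia
        simp [runBlock, h1, h2, h3]
    · obtain ⟨t, m', hex, ht, h14, hm'⟩ := ih e (by lia)
        (runBlock [(16, .div, .reg 16, .const 2)] (runBlock [(14, .mul, .reg 14, .reg 14)] m))
        (by simp [runBlock, h15])
        (by simp [runBlock, Operand.eval, ArithOp.eval, Addr.eval, h16'])
      refine ⟨_, m', Exec.while_true hcond (Exec.seq (exec_block _ _ _)
        (Exec.seq (Exec.ite_false ?_ (Exec.skip _)) (exec_block _ _ _))) hex, ?_, ?_, ?_⟩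
      · simp only [Cmp.Holds, Operand.eval, Addr.eval, runBlock]
        simp [h15, h16']
        exact_mod_cast not_le.1 hje
      · simp only [List.length_cons, List.length_nil]
        lia
      · rw [h14]
        simp [runBlock, Operand.eval, ArithOp.eval, Addr.eval]
        exact Or.inl (by ring)
      · intro i hi
        rw [hm' i hi]
        have h1 : i ≠ 14 := by lia
        have h3 : i ≠ 16 := by lia
        simp [runBlock, h1, h3]

/-- The `k`-th term of the probability of connectivity. -/
def pconTerm (s d : ℚ) (n k : ℕ) : ℚ :=
  if k < s / d then (-1) ^ k * ((n + 1).choose k) * (1 - k * d / s) ^ n else 0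

/-- The probability of connectivity as a rational number. -/
def pconRat (s d : ℚ) (n : ℕ) : ℚ := ∑ k ∈ Finset.range (n + 2), pconTerm s d n k

lemma cast_pconRat {s d : ℚ} (hs : 0 < s) (hd : 0 < d) (n : ℕ) :
    (pconRat s d n : ℝ) = pcon s d n := by
  rw [pcon_eq_sum (by exact_mod_cast hs) (by exact_mod_cast hd), pconRat, Rat.cast_sum]
  refine Finset.sum_congr rfl fun k _ => ?_
  have hiff : (k : ℚ) < s / d ↔ 0 < 1 - (k : ℝ) * d / s := by
    rw [lt_div_iff₀ hd, sub_pos, div_lt_one (by exact_mod_cast hs)]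
    exact_mod_cast Iff.rfl
  unfold pconTerm posPow
  by_cases h : (k : ℚ) < s / d
  · rw [if_pos h, if_pos (hiff.1 h)]
    push_cast
    rfl
  · rw [if_neg h, if_neg (hiff.not.1 h)]
    simp

/-- Justifies the constant-cost update of the signed binomial coefficient in the cell `11`. -/
lemma neg_coeff_step (n k : ℕ) (hk : k ≤ n + 1) :
    0 - (-1 : ℚ) ^ k * ((n + 1).choose k) * ((n : ℚ) + 1 - k) / (k + 1) =
      (-1) ^ (k + 1) * ((n + 1).choose (k + 1)) := by
  have h := Nat.choose_succ_right_eq (n + 1) k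
  have h' : (((n + 1).choose (k + 1) : ℕ) : ℚ) * (k + 1) = (n + 1).choose k * ((n : ℚ) + 1 - k) := by
    have := congrArg (Nat.cast : ℕ → ℚ) h
    push_cast [Nat.cast_sub hk] at this
    exact this
  have hk0 : (k : ℚ) + 1 ≠ 0 := by positivity
  rw [mul_assoc, ← h']
  field_simp
  ring

/-- Here `r` bounds the number of rounds left. One round costs at most `7 + (9 * (n.size + 1) + 1) +
9 + 1 = 9 * n.size + 27`. -/
lemma exec_sumLoop {s d : ℚ} (n r k : ℕ) (hk : k + r = n + 2) (m : ℕ → ℚ) (out : List Sym)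
    (h4 : m 4 = n) (h5 : m 5 = s) (h6 : m 6 = d) (h7 : m 7 = min (s / d) (n + 2))
    (h9 : m 9 = 2 ^ n.size) (h10 : m 10 = k) (h11 : m 11 = (-1) ^ k * ((n + 1).choose k))
    (h12 : m 12 = ∑ i ∈ Finset.range k, pconTerm s d n i) :
    ∃ t m', Exec sumLoop ⟨m, out⟩ t ⟨m', out⟩ ∧ t ≤ r * (9 * n.size + 27) + 1 ∧
      m' 12 = pconRat s d n := by
  induction r generalizing k m with
  | zero =>
    refine ⟨1, m, Exec.while_false ?_, by lia, by rw [h12, pconRat, ← hk, add_zero]⟩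
    have : (k : ℚ) = n + 2 := by exact_mod_cast hk
    simp [Cmp.Holds, Operand.eval, Addr.eval, h7, h10, this]
  | succ r ih =>
    have hkn : (k : ℚ) < n + 2 := by exact_mod_cast (show k < n + 2 by lia)
    by_cases hks : (k : ℚ) < s / d
    · set m₁ := runBlock [(13, .mul, .reg 10, .reg 6), (13, .div, .reg 13, .reg 5),
        (13, .sub, .const 1, .reg 13), (14, .add, .const 1, .const 0),
        (15, .add, .reg 4, .const 0), (16, .add, .reg 9, .const 0)] m with hm₁
      have h13₁ : m₁ 13 = 1 - k * d / s := by
        simp [hm₁, runBlock, Operand.eval, ArithOp.eval, Addr.eval, h5, h6, h10]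
      have h14₁ : m₁ 14 = 1 := by
        simp [hm₁, runBlock, Operand.eval, ArithOp.eval]
      have h15₁ : m₁ 15 = n := by
        simp [hm₁, runBlock, Operand.eval, ArithOp.eval, Addr.eval, h4]
      -- The cell starts at `2 ^ n.size`, one place above the leading digit of `n`, so the power
      -- loop runs `n.size + 1` rounds, the first of which only squares `1`.
      have h16₁ : m₁ 16 = 2 ^ (n.size + 1) / 2 := by
        rw [pow_succ, mul_div_cancel_right₀ _ (by norm_num)]
        simp [hm₁, runBlock, Operand.eval, ArithOp.eval, Addr.eval, h9]
      have hlow₁ : ∀ i < 13, m₁ i = m i := by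
        intro i hi
        have h1 : i ≠ 13 := by lia
        have h2 : i ≠ 14 := by lia
        have h3 : i ≠ 15 := by lia
        have h4 : i ≠ 16 := by lia
        simp [hm₁, runBlock, h1, h2, h3, h4]
      have hlt : n < 2 ^ (n.size + 1) := (Nat.lt_size_self n).trans_le
        (Nat.pow_le_pow_right (by norm_num) (Nat.le_succ _))
      obtain ⟨t₂, m₂, he₂, ht₂, h14₂, hlow₂⟩ :=
        exec_powerLoop (n.size + 1) n hlt m₁ out h15₁ h16₁
      rw [h14₁, one_pow, one_mul, h13₁] at h14₂
      have hlow : ∀ i < 13, m₂ i = m i := fun i hi => by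
        rw [hlow₂ i (by lia), hlow₁ i hi]
      set m₃ := runBlock [(14, .mul, .reg 14, .reg 11), (12, .add, .reg 12, .reg 14),
          (17, .add, .reg 4, .const 1), (17, .sub, .reg 17, .reg 10),
          (11, .mul, .reg 11, .reg 17), (10, .add, .reg 10, .const 1),
          (11, .div, .reg 11, .reg 10), (11, .sub, .const 0, .reg 11)] m₂ with hm₃
      have hlow₃ : ∀ i < 10, m₃ i = m i := by
        intro i hi
        have h1 : i ≠ 10 := by lia
        have h2 : i ≠ 11 := by lia
        have h3 : i ≠ 12 := by lia
        have h4 : i ≠ 14 := by lia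
        have h5 : i ≠ 17 := by lia
        simp [hm₃, runBlock, h1, h2, h3, h4, h5, hlow i (by lia)]
      have h10₃ : m₃ 10 = (k + 1 : ℕ) := by
        simp [hm₃, runBlock, Operand.eval, ArithOp.eval, Addr.eval, hlow, h10]
      have h11₃ : m₃ 11 = (-1) ^ (k + 1) * ((n + 1).choose (k + 1)) := by
        rw [← neg_coeff_step n k (by lia)]
        simp [hm₃, runBlock, Operand.eval, ArithOp.eval, Addr.eval, hlow, h10, h4, h11]
      have h12₃ : m₃ 12 = ∑ i ∈ Finset.range (k + 1), pconTerm s d n i := by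
        rw [Finset.sum_range_succ, pconTerm, if_pos hks, ← h12]
        simp [hm₃, runBlock, Operand.eval, ArithOp.eval, Addr.eval, hlow, h11, h14₂]
        ring
      obtain ⟨t₄, m₄, he₄, ht₄, h12₄⟩ := ih (k + 1) (by lia) m₃
        (by rw [hlow₃ _ (by norm_num), h4]) (by rw [hlow₃ _ (by norm_num), h5])
        (by rw [hlow₃ _ (by norm_num), h6]) (by rw [hlow₃ _ (by norm_num), h7])
        (by rw [hlow₃ _ (by norm_num), h9]) h10₃ h11₃ h12₃
      refine ⟨_, m₄, Exec.while_true ?_ (Exec.seq (exec_block _ _ _)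
        (Exec.seq he₂ (exec_block _ _ _))) he₄, ?_, h12₄⟩
      · simp [Cmp.Holds, Operand.eval, Addr.eval, h7, h10, hks, hkn]
      · simp only [List.length_cons, List.length_nil]
        rw [Nat.succ_mul]
        lia
    -- Once `k` reaches `s / d`, all remaining terms are zero, so the loop may stop early.
    · refine ⟨1, m, Exec.while_false ?_, by lia, ?_⟩
      · simp [Cmp.Holds, Operand.eval, Addr.eval, h7, h10, not_lt.1 hks]
      · rw [h12, pconRat]
        refine Finset.sum_subset (Finset.range_mono (by lia)) fun i _ hi => if_neg ?_
        have : (k : ℚ) ≤ i := by exact_mod_cast not_lt.1 (Finset.mem_range.not.1 hi)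
        exact fun h => hks (this.trans_lt h)

/-- The program writes the probability of connectivity. -/
theorem outputs_pconProgram (s d : ℚ) (n : ℕ) :
    ∃ t, Outputs pconProgram s d n (t + ratSize (pconRat s d n)) (pconRat s d n) ∧
      t ≤ (n + 2) * (9 * n.size + 27) + 3 * n.size + 12 := by
  set m₁ := runBlock [(5, .div, .reg 0, .reg 1), (6, .div, .reg 2, .reg 3),
    (7, .div, .reg 5, .reg 6), (8, .add, .reg 4, .const 2), (9, .add, .const 1, .const 0),
    (11, .add, .const 1, .const 0)] (initConfig s d n).mem with hm₁
  have h4₁ : m₁ 4 = n := by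
    simp [hm₁, runBlock, initConfig]
  have h5₁ : m₁ 5 = s := by
    simp [hm₁, runBlock, Operand.eval, ArithOp.eval, Addr.eval, initConfig, Rat.num_div_den]
  have h6₁ : m₁ 6 = d := by
    simp [hm₁, runBlock, Operand.eval, ArithOp.eval, Addr.eval, initConfig, Rat.num_div_den]
  have h7₁ : m₁ 7 = s / d := by
    simp [hm₁, runBlock, Operand.eval, ArithOp.eval, Addr.eval, initConfig, Rat.num_div_den]
  have h8₁ : m₁ 8 = n + 2 := by
    simp [hm₁, runBlock, Operand.eval, ArithOp.eval, Addr.eval, initConfig]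
  have h9₁ : m₁ 9 = 2 ^ 0 := by
    simp [hm₁, runBlock, Operand.eval, ArithOp.eval]
  have h10₁ : m₁ 10 = 0 := by
    simp [hm₁, runBlock, initConfig]
  have h11₁ : m₁ 11 = 1 := by
    simp [hm₁, runBlock, Operand.eval, ArithOp.eval]
  have h12₁ : m₁ 12 = 0 := by
    simp [hm₁, runBlock, initConfig]
  -- Capping the loop bound at `n + 2` makes the running time before printing independent of `s` and
  -- `d`.
  obtain ⟨t₂, m₂, he₂, ht₂, h7₂, hm₂⟩ : ∃ t₂ m₂,
      Exec (.ite .lt (.reg 8) (.reg 7) (block [(7, .add, .reg 8, .const 0)]) .skip) ⟨m₁, []⟩ t₂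
        ⟨m₂, []⟩ ∧ t₂ ≤ 3 ∧ m₂ 7 = min (s / d) (n + 2) ∧ ∀ i, i ≠ 7 → m₂ i = m₁ i := by
    by_cases h : (n : ℚ) + 2 < s / d
    · refine ⟨_, _, Exec.ite_true ?_ (exec_block _ _ _), by simp, ?_, ?_⟩
      · simpa [Cmp.Holds, Operand.eval, Addr.eval, h7₁, h8₁] using h
      · simp [runBlock, Operand.eval, ArithOp.eval, Addr.eval, h8₁, h.le]
      · intro i hi
        simp [runBlock, hi]
    · refine ⟨_, _, Exec.ite_false ?_ (Exec.skip _), by simp, ?_, fun _ _ => rfl⟩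
      · simpa [Cmp.Holds, Operand.eval, Addr.eval, h7₁, h8₁] using h
      · rw [h7₁, min_eq_left (not_lt.1 h)]
  obtain ⟨t₃, m₃, he₃, ht₃, h9₃, hm₃⟩ := exec_doublingLoop n n.size 0 (zero_add _) m₂ []
    (by rw [hm₂ _ (by norm_num), h4₁]) (by rw [hm₂ _ (by norm_num), h9₁])
  have hm : ∀ i, i ≠ 9 → i ≠ 7 → m₃ i = m₁ i := fun i h h' => by rw [hm₃ i h, hm₂ i h']
  obtain ⟨t₄, m₄, he₄, ht₄, h12₄⟩ := exec_sumLoop (s := s) (d := d) n (n + 2) 0 (zero_add _) m₃ []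
    (by rw [hm _ (by norm_num) (by norm_num), h4₁]) (by rw [hm _ (by norm_num) (by norm_num), h5₁])
    (by rw [hm _ (by norm_num) (by norm_num), h6₁]) (by rw [hm₃ _ (by norm_num), h7₂]) h9₃
    (by rw [hm _ (by norm_num) (by norm_num), h10₁]; simp)
    (by rw [hm _ (by norm_num) (by norm_num), h11₁]; simp)
    (by rw [hm _ (by norm_num) (by norm_num), h12₁]; simp)
  have hprint := Exec.print (.reg 12) ⟨m₄, []⟩
  have hval : (Operand.reg 12).eval m₄ = pconRat s d n := h12₄
  simp only [hval, List.nil_append] at hprint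
  refine ⟨7 + (t₂ + (t₃ + t₄)), ⟨m₄, ?_⟩, by lia⟩
  have := Exec.seq (exec_block _ (initConfig s d n).mem [])
    (Exec.seq he₂ (Exec.seq he₃ (Exec.seq he₄ hprint)))
  rw [show 7 + (t₂ + (t₃ + t₄)) + ratSize (pconRat s d n) =
    7 + (t₂ + (t₃ + (t₄ + ratSize (pconRat s d n)))) by lia]
  exact this

end SCS

namespace SCS

/-! ### Sizes of rational numbers -/

lemma ratSize_eq (q : ℚ) :
    ratSize q = (if q < 0 then 1 else 0) + q.num.natAbs.size + 1 + q.den.size := by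
  unfold ratSize encodeRat
  split_ifs <;> simp [Nat.size_eq_bits_len] <;> lia

lemma size_num_le_ratSize (q : ℚ) : q.num.natAbs.size ≤ ratSize q := by
  rw [ratSize_eq]; lia

lemma size_den_le_ratSize (q : ℚ) : q.den.size ≤ ratSize q := by
  rw [ratSize_eq]; lia

lemma size_mul_le (a b : ℕ) : (a * b).size ≤ a.size + b.size := by
  rw [Nat.size_le, pow_add]
  exact Nat.mul_lt_mul'' (Nat.lt_size_self a) (Nat.lt_size_self b)

lemma size_pow_le (a n : ℕ) : (a ^ n).size ≤ n * a.size + 1 := by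
  induction n with
  | zero => simp
  | succ n ih =>
    rw [pow_succ, Nat.succ_mul]
    have := size_mul_le (a ^ n) a
    lia

/-- The reduced denominator divides `D`, the numerator is at most the denominator, and the slash
adds one symbol. -/
lemma ratSize_le_of_mem_unitInterval {q : ℚ} (h0 : 0 ≤ q) (h1 : q ≤ 1) {D : ℕ} (hD : 0 < D)
    {N : ℤ} (h : q * D = N) : ratSize q ≤ 2 * D.size + 1 := by
  have hq : q = ((N : ℤ) : ℚ) / ((D : ℤ) : ℚ) := by
    rw [← h, Int.cast_natCast, mul_div_cancel_right₀]
    positivity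
  have hdvd : (q.den : ℤ) ∣ (D : ℤ) := by
    rw [hq, ← Rat.divInt_eq_div]
    exact Rat.den_dvd N D
  have hden : q.den.size ≤ D.size :=
    Nat.size_le_size (Nat.le_of_dvd hD (Int.natCast_dvd_natCast.1 hdvd))
  have hnum : q.num.natAbs.size ≤ q.den.size := by
    refine Nat.size_le_size ?_
    have h2 : q.num ≤ q.den := by
      have := Rat.num_le_denom_iff.2 h1
      exact this
    have := Rat.num_nonneg.2 h0
    lia
  rw [ratSize_eq, if_neg (not_lt.2 h0)]
  lia

/-- Reduction cancels at most a factor `n + 1` of `4 ^ n`: from `den * (n + 1) = 4 ^ n * (den -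
num)` and `n + 1 ≤ 2 ^ n` it follows that `2 ^ n ≤ den`. -/
lemma le_ratSize_one_sub_div (n : ℕ) : n ≤ ratSize (1 - (n + 1) / 4 ^ n) := by
  set q : ℚ := 1 - (n + 1) / 4 ^ n with hq
  have h1 : (q.den : ℚ) * (n + 1) = 4 ^ n * (q.den - q.num) := by
    have h2 : q * q.den = q.num := Rat.mul_den_eq_num q
    rw [← h2, hq]
    field_simp
    ring
  have h3 : (q.den : ℤ) * (n + 1) = 4 ^ n * (q.den - q.num) := by exact_mod_cast h1
  have h4 : 0 < (q.den : ℤ) - q.num := by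
    refine pos_of_mul_pos_right (a := 4 ^ n) ?_ (by positivity)
    rw [← h3]
    have := q.den_pos
    positivity
  have h5 : (4 : ℤ) ^ n ≤ q.den * 2 ^ n := by
    have h6 : ((n : ℤ) + 1) ≤ 2 ^ n := by exact_mod_cast Nat.lt_two_pow_self
    calc (4 : ℤ) ^ n ≤ 4 ^ n * (q.den - q.num) := le_mul_of_one_le_right (by positivity) h4
      _ = q.den * (n + 1) := h3.symm
      _ ≤ q.den * 2 ^ n := by gcongr
  have h7 : 2 ^ n ≤ q.den := by
    have h8 : (4 : ℤ) ^ n = 2 ^ n * 2 ^ n := by rw [← mul_pow]; norm_num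
    rw [h8] at h5
    exact_mod_cast le_of_mul_le_mul_right h5 (by positivity)
  exact (Nat.lt_size.2 h7).le.trans (size_den_le_ratSize q)

/-! ### The size of the probability of connectivity -/

lemma pcon_mem_unitInterval {s : ℝ} (hs : 0 < s) (d : ℝ) (n : ℕ) :
    0 ≤ pcon s d n ∧ pcon s d n ≤ 1 := by
  have : MeasureTheory.IsProbabilityMeasure
      (ProbabilityTheory.cond MeasureTheory.volume (Set.Icc (0 : ℝ) s)) :=
    ProbabilityTheory.cond_isProbabilityMeasure_of_finite (by simp [hs]) (by simp)
  have : MeasureTheory.IsProbabilityMeasure (uniformPositions s n) := by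
    unfold uniformPositions; infer_instance
  exact ⟨MeasureTheory.measureReal_nonneg, MeasureTheory.measureReal_le_one⟩

lemma exists_int_pconTerm_mul (s d : ℚ) (hs : 0 < s) (n k : ℕ) :
    ∃ N : ℤ, pconTerm s d n k * ((s.num.natAbs * d.den) ^ n : ℕ) = N := by
  unfold pconTerm
  split_ifs
  · refine ⟨(-1) ^ k * ((n + 1).choose k) * (s.num * d.den - k * d.num * s.den) ^ n, ?_⟩
    have hnum : ((s.num.natAbs : ℕ) : ℚ) = s.num := by
      rw [Nat.cast_natAbs, abs_of_nonneg (Rat.num_nonneg.2 hs.le)]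
    push_cast
    rw [hnum, mul_assoc, ← mul_pow]
    congr 2
    have h1 : (s.num : ℚ) = s * s.den := (Rat.mul_den_eq_num s).symm
    have h2 : (d.num : ℚ) = d * d.den := (Rat.mul_den_eq_num d).symm
    rw [h1, h2]
    field_simp
  · exact ⟨0, by simp⟩

/-- That the value is a probability bounds the numerator, so no estimate of the alternating sum is
needed. -/
lemma ratSize_pconRat_le {s d : ℚ} (hs : 0 < s) (hd : 0 < d) (n : ℕ) :
    ratSize (pconRat s d n) ≤ 2 * (n * (ratSize s + ratSize d)) + 3 := by
  have hmem := pcon_mem_unitInterval (s := s) (by exact_mod_cast hs) d n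
  rw [← cast_pconRat hs hd] at hmem
  choose N hN using exists_int_pconTerm_mul s d hs n
  have hpos : 0 < s.num.natAbs * d.den :=
    Nat.mul_pos (Int.natAbs_pos.2 (Rat.num_pos.2 hs).ne') d.den_pos
  have h := ratSize_le_of_mem_unitInterval (q := pconRat s d n) (by exact_mod_cast hmem.1)
    (by exact_mod_cast hmem.2) (D := (s.num.natAbs * d.den) ^ n) (by positivity)
    (N := ∑ k ∈ Finset.range (n + 2), N k) (by
      rw [pconRat, Finset.sum_mul, Int.cast_sum]
      exact Finset.sum_congr rfl fun k _ => hN k)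
  have h2 := size_pow_le (s.num.natAbs * d.den) n
  have h3 : n * (s.num.natAbs * d.den).size ≤ n * (ratSize s + ratSize d) :=
    Nat.mul_le_mul_left n ((size_mul_le _ _).trans
      (add_le_add (size_num_le_ratSize s) (size_den_le_ratSize d)))
  lia

/-! ### Bounds for the running time -/

/-- With `n.size = k + 1`, `2 ^ k ≤ n` and `2 * Real.log 2 > 1` give the bound. -/
lemma size_le_two_mul_log_add_one (n : ℕ) : (n.size : ℝ) ≤ 2 * Real.log n + 1 := by
  rcases Nat.eq_zero_or_pos n with rfl | hn
  · simp
  have hsize : 0 < n.size := Nat.size_pos.2 hn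
  obtain ⟨k, hk⟩ := Nat.exists_eq_add_of_le' hsize
  have hle : 2 ^ k ≤ n := Nat.lt_size.1 (by lia)
  have hlog : k * Real.log 2 ≤ Real.log n := by
    rw [← Real.log_pow]
    exact Real.log_le_log (by positivity) (by exact_mod_cast hle)
  have h2 := Real.log_two_gt_d9
  have hk0 : (0 : ℝ) ≤ k := Nat.cast_nonneg k
  rw [hk]
  push_cast
  nlinarith

lemma half_le_log {n : ℕ} (hn : 2 ≤ n) : 1 / 2 ≤ Real.log n := by
  have h2 := Real.log_two_gt_d9
  have : Real.log 2 ≤ Real.log n := Real.log_le_log (by norm_num) (by exact_mod_cast hn)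
  linarith

lemma steps_le (n : ℕ) :
    (((n + 2) * (9 * n.size + 27) + 3 * n.size + 12 : ℕ) : ℝ) ≤ 276 * (n * Real.log n + 1) := by
  rcases Nat.eq_zero_or_pos n with rfl | hn
  · norm_num
  have hsize := size_le_two_mul_log_add_one n
  have hn1 : (1 : ℝ) ≤ n := by exact_mod_cast hn
  have hL : 0 ≤ Real.log n := Real.log_nonneg hn1
  have hnL : (n : ℝ) ≤ 2 * (n * Real.log n) + 1 := by
    rcases Nat.lt_or_ge n 2 with h | h
    · obtain rfl : n = 1 := by lia
      simp
    · nlinarith [half_le_log h]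
  have hLn : Real.log n ≤ n * Real.log n := le_mul_of_one_le_left hL hn1
  push_cast
  calc ((n : ℝ) + 2) * (9 * n.size + 27) + 3 * n.size + 12
      ≤ (n + 2) * (9 * (2 * Real.log n + 1) + 27) + 3 * (2 * Real.log n + 1) + 12 := by gcongr
    _ = 18 * (n * Real.log n) + 36 * n + 42 * Real.log n + 87 := by ring
    -- Writing `X` for `n * Real.log n`, the bounds `n ≤ 2 * X + 1` and `Real.log n ≤ X` already
    -- give `132 * X + 123`.
    _ ≤ 276 * (n * Real.log n + 1) := by linarith

/-- Every symbol written takes one unit of time. -/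
lemma Exec.length_out_le {P : Program} {σ τ : Config} {t : ℕ} (h : Exec P σ t τ) :
    τ.out.length ≤ σ.out.length + t := by
  induction h with
  | skip | assign => simp
  | emit => simp
  | print => simp [ratSize]
  | seq | ite_true | ite_false | while_true | while_false => lia

/-! ### The instances with `s = 4 d / 3` -/

/-- Only `k = 0` and `k = 1` survive, since `2 * (3 / 4) > 1`: two gaps longer than `d` do not fit.
-/
lemma pcon_four_thirds {d : ℝ} (hd : 0 < d) (n : ℕ) :
    pcon (4 / 3 * d) d n = 1 - (n + 1) / 4 ^ n := by
  have hterm : ∀ k : ℕ, 1 - (k : ℝ) * d / (4 / 3 * d) = 1 - k * (3 / 4) := fun k => by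
    field_simp
  rw [pcon_eq_sum (by positivity) hd, Finset.sum_range_succ', Finset.sum_range_succ']
  simp_rw [hterm]
  rw [Finset.sum_eq_zero]
  · have h1 : (1 : ℝ) - (0 + 1 : ℕ) * (3 / 4) = 1 / 4 := by norm_num
    rw [h1, posPow_of_pos n (by norm_num), posPow_of_pos n (by norm_num)]
    simp
    ring
  · intro k _
    rw [posPow_of_nonpos, mul_zero]
    push_cast
    linarith [(Nat.cast_nonneg k : (0 : ℝ) ≤ k)]

end SCS

/-! ### Assembly of the four claims -/

theorem mainTheorem1 :
    -- the exact connectivity probability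
    (∀ (s d : ℝ) (n : ℕ), 0 < s → 0 < d → 1 ≤ n →
      SCS.pcon s d n =
        1 - ∑ k ∈ Finset.Icc 1 ⌊s / d⌋₊,
          (-1 : ℝ) ^ (k - 1) * ((n + 1).choose k : ℝ) * (1 - (k : ℝ) * d / s) ^ n) ∧
    -- the upper bound: one program for all inputs, with one constant
    (∃ (P : SCS.Program) (C : ℝ), ∀ (s d : ℚ) (n : ℕ), 0 < s → 0 < d →
      ∃ (t : ℕ) (q : ℚ), (q : ℝ) = SCS.pcon s d n ∧ SCS.Outputs P s d n t q ∧
        (t : ℝ) ≤ C * (n * Real.log n + 1) + SCS.ratSize q ∧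
        (t : ℝ) ≤ C * (n * (Real.log n + SCS.ratSize s + SCS.ratSize d) + 1)) ∧
    -- the lower bound, for every program, on the instances with `s = 4 d / 3`
    (∀ (P : SCS.Program) (d : ℚ) (n t : ℕ), 0 < d →
      SCS.SolvesIn P (4 / 3 * d) d n t → n ≤ t) ∧
    -- on these instances the output is exponentially large relative to the input
    (∀ d : ℚ, 0 < d →
      (∀ n : ℕ, ∃ q : ℚ, (q : ℝ) = SCS.pcon ((4 / 3 * d : ℚ) : ℝ) d n ∧
        q = 1 - (n + 1) / 4 ^ n ∧ n ≤ SCS.ratSize q) ∧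
      ∃ C : ℝ, ∀ n : ℕ, 2 ≤ n → (SCS.inputSize (4 / 3 * d) d n : ℝ) ≤ C * Real.log n) := by
  have hpcon : ∀ (d : ℚ) (n : ℕ), 0 < d →
      ((1 - (n + 1) / 4 ^ n : ℚ) : ℝ) = SCS.pcon ((4 / 3 * d : ℚ) : ℝ) d n := by
    intro d n hd
    push_cast
    exact (SCS.pcon_four_thirds (by exact_mod_cast hd) n).symm
  refine ⟨fun s d n hs hd hn => SCS.pcon_eq_one_sub_sum hs hd hn,
    -- The constant is `276` from `steps_le` plus the additive `3` in `ratSize_pconRat_le`.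
    ⟨SCS.pconProgram, 279, fun s d n hs hd => ?_⟩, fun P d n t hd hsolves => ?_, fun d hd =>
    ⟨fun n => ⟨_, hpcon d n hd, rfl, SCS.le_ratSize_one_sub_div n⟩, ?_⟩⟩
  · obtain ⟨t, hout, ht⟩ := SCS.outputs_pconProgram s d n
    have ht' : (t : ℝ) ≤ 276 * (n * Real.log n + 1) :=
      le_trans (by exact_mod_cast ht) (SCS.steps_le n)
    have hsize : (SCS.ratSize (SCS.pconRat s d n) : ℝ) ≤
        2 * (n * (SCS.ratSize s + SCS.ratSize d)) + 3 := by
      exact_mod_cast SCS.ratSize_pconRat_le hs hd n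
    have hlog : 0 ≤ n * Real.log n := by positivity
    have hn : (0 : ℝ) ≤ n * (SCS.ratSize s + SCS.ratSize d) := by positivity
    refine ⟨_, _, SCS.cast_pconRat hs hd n, hout, ?_, ?_⟩
    · push_cast
      linarith
    · push_cast
      rw [add_assoc, mul_add (n : ℝ)]
      linarith
  · obtain ⟨q, hq, m, hexec⟩ := hsolves
    have hq' : q = 1 - (n + 1) / 4 ^ n := by
      rw [← hpcon d n hd] at hq
      exact_mod_cast hq
    have hle := hexec.length_out_le
    have hsize := SCS.le_ratSize_one_sub_div n
    rw [← hq'] at hsize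
    exact hsize.trans (by simpa [SCS.initConfig, SCS.ratSize] using hle)
  -- Since `1 ≤ 2 * Real.log n`, the fixed size `A` of the two rationals costs `2 * A * Real.log n`,
  -- and `n.size ≤ 2 * Real.log n + 1 ≤ 4 * Real.log n`.
  · refine ⟨2 * (SCS.ratSize (4 / 3 * d) + SCS.ratSize d) + 4, fun n hn => ?_⟩
    have hlog := SCS.half_le_log hn
    have hsize := SCS.size_le_two_mul_log_add_one n
    have hA : (0 : ℝ) ≤ SCS.ratSize (4 / 3 * d) + SCS.ratSize d := by positivity
    rw [SCS.inputSize, Nat.size_eq_bits_len]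
    push_cast
    nlinarith
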